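/- Let $\mathcal A$ be a unital C$^*$-algebra and $\mathcal D=\{z\in\mathcal A:\|z\|<1\}$. Regard $\mathcal A^2$ (columns) as a right Hilbert C$^*$-module over $\mathcal A$ with norm $\|\mathbf x\|=\|x_1^*x_1+x_2^*x_2\|^{1/2}$, and put $\theta(\mathbf x,\mathbf y)=x_1^*y_1-x_2^*y_2$. For $z\in\mathcal D$ let $\ell_z=\{\binom1z a:a\in\mathcal A\}\subset\mathcal A^2$, and let $\mathbf e_z=\binom1z(1-z^*z)^{-1/2}$, a generator of $\ell_z$ with $\theta(\mathbf e_z,\mathbf e_z)=1$. The cross ratio $cr(0,z)$ is the module endomorphism of $\ell_z$ given by $$cr(0,z)\Big(\binom1z a\Big)=\binom1z(1+|z|)(1-|z|)^{-1}a,\qquad a\in\mathcal A,\quad |z|=(z^*z)^{1/2}.$$ Its logarithm $\log cr(0,z)$ is taken by identifying each module endomorphism $\varphi$ of $\ell_z$ with its matrix $m\in\mathcal A$ in the basis $\mathbf e_z$ (that is, $\varphi(\mathbf e_z)=\mathbf e_z m$) and taking the logarithm in $\mathcal A$. For $z\in\mathcal D$ and $X\in\mathcal A$, let $|X|_z=\|\theta(\mathbf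 v,\mathbf v)\|^{1/2}$, where $\mathbf v$ is the element of the $\theta$-orthogonal complement of $\ell_z$ that is congruent modulo $\ell_z$ to $\binom0X(1-z^*z)^{-1/2}$. This is the Finsler metric of $\mathcal D$; let $d(z_0,z_1)$ be the infimum of the lengths $\int_0^1|\dot\gamma(t)|_{\gamma(t)}\,dt$ of the $C^1$ curves $\gamma:[0,1]\to\mathcal D$ from $z_0$ to $z_1$. Then for every $z\in\mathcal D$ $$\tfrac12\,\|\log cr(0,z)\|_{\mathcal B(\ell_z)}=d(0,z)=\tfrac12\log\frac{1+\|z\|}{1-\|z\|},$$ where $\|\ \|_{\mathcal B(\ell_z)}$ is the norm of operators acting on $\ell_z\subset\mathcal A^2$. -/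

import Mathlib

open scoped RightActions WithCStarModule

noncomputable section

namespace PoincareDisk

/-- The C⋆-algebra `A` as a right Hilbert C⋆-module over itself, with `⟪x, y⟫ = x⋆ y`. A right
`A`-module is a module over the opposite algebra `Aᵐᵒᵖ`. -/
instance instRightCStarModule {A : Type*} [CStarAlgebra A] [PartialOrder A] [StarOrderedRing A] :
    CStarModule Aᵐᵒᵖ A where
  inner x y := MulOpposite.op (star x * y)
  inner_add_right := by simp [mul_add]
  inner_self_nonneg {x} := by
    have h : (0 : A) ≤ star x * x := star_mul_self_nonneg x
    exact h
  inner_self {x} := by simp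
  inner_op_smul_right {a x y} := by
    simp [MulOpposite.smul_eq_mul_unop, ← mul_assoc]
  inner_smul_right_complex := by simp
  star_inner x y := by simp [← MulOpposite.op_star]
  norm_eq_sqrt_norm_inner_self x := by
    rw [MulOpposite.norm_op, CStarRing.norm_star_mul_self, Real.sqrt_mul_self (norm_nonneg x)]

variable {A : Type*} [CStarAlgebra A]

/-- The standard right Hilbert C⋆-module `A² = A × A`, with `A`-valued inner product
`x₁⋆ y₁ + x₂⋆ y₂` and norm `‖x₁⋆ x₁ + x₂⋆ x₂‖ ^ (1/2)`. -/
abbrev A2 (A : Type*) [CStarAlgebra A] : Type _ := C⋆ᵐᵒᵈ(Aᵐᵒᵖ, A × A)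

/-- The column vector with entries `x₁`, `x₂`. -/
def col (x₁ x₂ : A) : A2 A := (WithCStarModule.equiv Aᵐᵒᵖ (A × A)).symm (x₁, x₂)

/-- The indefinite form `θ(x, y) = x₁⋆ y₁ - x₂⋆ y₂`. -/
def theta (x y : A2 A) : A := star x.1 * y.1 - star x.2 * y.2

/-- The submodule `ℓ_z = {(1, z) a : a ∈ A}` of `A²`. -/
def line (z : A) : Submodule Aᵐᵒᵖ (A2 A) := Submodule.span Aᵐᵒᵖ {col 1 z}

theorem col_smul_mem_line (z a : A) : col 1 z <• a ∈ line z :=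
  Submodule.smul_mem _ _ (Submodule.mem_span_singleton_self _)

/-- The module endomorphism `(1, z) a ↦ (1, z) (b a)` of `ℓ_z`. -/
def endo (z b : A) : line z →ₗ[Aᵐᵒᵖ] line z where
  toFun x := ⟨col 1 z <• (b * x.1.1), col_smul_mem_line z _⟩
  map_add' x y := by
    ext1
    change col 1 z <• (b * (x.1.1 + y.1.1)) = col 1 z <• (b * x.1.1) + col 1 z <• (b * y.1.1)
    rw [mul_add, MulOpposite.op_add, add_smul]
  map_smul' c x := by
    ext1
    change col 1 z <• (b * (x.1.1 * c.unop)) = c • (col 1 z <• (b * x.1.1))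
    rw [← mul_assoc, MulOpposite.op_mul, mul_smul, MulOpposite.op_unop]

theorem endo_apply (z b a : A) :
    endo z b ⟨col 1 z <• a, col_smul_mem_line z a⟩ =
      ⟨col 1 z <• (b * a), col_smul_mem_line z (b * a)⟩ := by
  ext1
  change col 1 z <• (b * (1 * a)) = col 1 z <• (b * a)
  rw [one_mul]

variable [PartialOrder A] [StarOrderedRing A]

/-- The operator norm of an endomorphism of `ℓ_z`, for the norm of `ℓ_z ⊆ A²`. -/
def opNorm {z : A} (φ : line z →ₗ[Aᵐᵒᵖ] line z) : ℝ :=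
  sInf {C : ℝ | 0 ≤ C ∧ ∀ x : line z, ‖(φ x : A2 A)‖ ≤ C * ‖(x : A2 A)‖}

/-- The cross ratio `cr(0, z)`: the endomorphism
`(1, z) a ↦ (1, z) (1 + |z|) (1 - |z|)⁻¹ a` of `ℓ_z`. -/
def crossRatio (z : A) : line z →ₗ[Aᵐᵒᵖ] line z :=
  endo z ((1 + CFC.abs z) * Ring.inverse (1 - CFC.abs z))

/-- `(1 - z⋆ z) ^ (1/2)`. -/
def defect (z : A) : A := CFC.sqrt (1 - star z * z)

/-- The generator `e_z = ((1 - z⋆ z) ^ (-1/2), z (1 - z⋆ z) ^ (-1/2))` of `ℓ_z`, which satisfies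
`θ(e_z, e_z) = 1`. -/
def gen (z : A) : A2 A := col 1 z <• Ring.inverse (defect z)

/-- The matrix of `φ` in the basis `e_z` of `ℓ_z`: the element `m` with `φ(e_z) = e_z m`. -/
def endMatrix {z : A} (φ : line z →ₗ[Aᵐᵒᵖ] line z) : A :=
  defect z * (φ ⟨gen z, col_smul_mem_line z _⟩ : A2 A).1

/-- The endomorphism of `ℓ_z` whose matrix in the basis `e_z` is `m`, i.e. `e_z a ↦ e_z (m a)`. -/
def ofMatrix (z m : A) : line z →ₗ[Aᵐᵒᵖ] line z :=
  endo z (Ring.inverse (defect z) * m * defect z)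

/-- The logarithm of an endomorphism of `ℓ_z`, where endomorphisms are identified with their
matrices in the basis `e_z`, and the logarithm in `A` is the one of the continuous functional
calculus. -/
def endLog {z : A} (φ : line z →ₗ[Aᵐᵒᵖ] line z) : line z →ₗ[Aᵐᵒᵖ] line z :=
  ofMatrix z (CFC.log (endMatrix φ))

/-- The representative in `A²` of the tangent vector `X` of the disk at `z`: the derivative at
`t = 0` of the curve `(1, z + t X) (1 - z⋆ z) ^ (-1/2)` of generators of `ℓ_{z + t X}`, which
starts at `e_z`. It is determined modulo `ℓ_z`. -/
def lift (z X : A) : A2 A := col 0 X <• Ring.inverse (defect z)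

/-- The representative of the tangent vector `X` in the `θ`-orthogonal complement of `ℓ_z`: the
lift of `X` minus its `θ`-orthogonal projection `e_z θ(e_z, lift)` to `ℓ_z`. -/
def tangentRep (z X : A) : A2 A := lift z X - gen z <• theta (gen z) (lift z X)

/-- The Finsler norm `|X|_z = ‖θ(v, v)‖ ^ (1/2)` of a tangent vector `X` at `z`, where `v` is its
representative in the `θ`-orthogonal complement of `ℓ_z`. -/
def finslerNorm (z X : A) : ℝ := √‖theta (tangentRep z X) (tangentRep z X)‖

/-- The length of the curve `γ : [0, 1] → A` for the Finsler metric of the disk. -/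
def length (γ : ℝ → A) : ℝ :=
  ∫ t in (0 : ℝ)..1, finslerNorm (γ t) (derivWithin γ (Set.Icc 0 1) t)

/-- The Finsler distance of the unit disk of `A`: the infimum of the lengths of the `C¹` curves
`[0, 1] → {a : ‖a‖ < 1}` from `z₀` to `z₁`. -/
def finslerDist (z₀ z₁ : A) : ℝ :=
  sInf {L : ℝ | ∃ γ : ℝ → A, ContDiffOn ℝ 1 γ (Set.Icc 0 1) ∧
    (∀ t ∈ Set.Icc (0 : ℝ) 1, ‖γ t‖ < 1) ∧ γ 0 = z₀ ∧ γ 1 = z₁ ∧ L = length γ}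

end PoincareDisk

end

/-
`A²` is the `θ`-orthogonal sum of `ℓ_z`, where `θ` is positive, and its complement, where `θ` is
negative; for a `θ`-null vector `v` the two components of `v` have equal size. When `z` moves with
velocity `X`, the derivative of the `A`-valued square `|θ(e_z, v)|²` couples these two components
through a coefficient of norm `|X|_z`, so this square grows at logarithmic rate at most `2 |X|_z`.
For the null vector `v = (|z|, -z)` the square grows, from `0` to `z`, exactly by the factor
`(1 + |z|) (1 - |z|)⁻¹` that defines the cross ratio; taking norms bounds the length of every curve
from `0` to `z` from below by `½ log ((1 + ‖z‖) / (1 - ‖z‖))`, and the segment `t ↦ t z` attains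
this bound. On the side of the cross ratio, `(1 + |z|) (1 - |z|)⁻¹` commutes with `z⋆ z`; its matrix
in the basis `e_z` is therefore itself, and the operator norm on `ℓ_z` is the norm of `A`.
-/

noncomputable section

namespace PoincareDisk

open Set
open scoped Ring

section RingInverse

variable {R : Type*} [Ring R] {a b : R}

theorem mul_inverse_one_sub_mul (hba : IsUnit (1 - b * a)) (hab : IsUnit (1 - a * b)) :
    a * (1 - b * a)⁻¹ʳ = (1 - a * b)⁻¹ʳ * a := by
  rw [← hab.mul_right_inj, ← mul_assoc, ← mul_assoc, Ring.mul_inverse_cancel _ hab, one_mul]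
  calc (1 - a * b) * a * (1 - b * a)⁻¹ʳ = a * ((1 - b * a) * (1 - b * a)⁻¹ʳ) := by noncomm_ring
    _ = a := by rw [Ring.mul_inverse_cancel _ hba, mul_one]

theorem inverse_one_sub_eq_one_add (ha : IsUnit (1 - a)) : (1 - a)⁻¹ʳ = 1 + a * (1 - a)⁻¹ʳ := by
  have h := Ring.mul_inverse_cancel _ ha
  rwa [sub_mul, one_mul, sub_eq_iff_eq_add] at h

theorem commute_inverse_one_sub (ha : IsUnit (1 - a)) : Commute a (1 - a)⁻¹ʳ := by
  have h := mul_inverse_one_sub_mul (a := a) (b := 1) (by rwa [one_mul]) (by rwa [mul_one])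
  rwa [one_mul, mul_one] at h

end RingInverse

section Calculus

theorem hasDerivAt_half_log_one_add_div_one_sub {r t : ℝ} (h : |t * r| < 1) :
    HasDerivAt (fun t => (1 / 2 : ℝ) * Real.log ((1 + t * r) / (1 - t * r)))
      (r / (1 - (t * r) ^ 2)) t := by
  obtain ⟨h₁, h₂⟩ := abs_lt.1 h
  have hadd : 1 + t * r ≠ 0 := by linarith
  have hsub : 1 - t * r ≠ 0 := by linarith
  have hsq : 1 - (t * r) ^ 2 ≠ 0 := by
    convert mul_ne_zero hadd hsub using 1
    ring
  have hlin : HasDerivAt (fun t => t * r) r t := by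
    simpa using (hasDerivAt_id t).mul_const r
  have hlog := (((hlin.const_add 1).fun_div (hlin.const_sub 1) hsub).log
    (div_ne_zero hadd hsub)).const_mul (1 / 2 : ℝ)
  refine hlog.congr_deriv ?_
  field_simp [hsq]
  ring

variable {E : Type*} [NormedAddCommGroup E] [NormedSpace ℝ E] [CompleteSpace E]

theorem hasDerivAt_integral_of_continuousOn {f : ℝ → E} {a b t : ℝ}
    (hf : ContinuousOn f (Icc a b)) (ht : t ∈ Ioo a b) :
    HasDerivAt (fun u => ∫ s in a..u, f s) (f t) t := by
  have hnhds := Icc_mem_nhds ht.1 ht.2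
  refine intervalIntegral.integral_hasDerivAt_right ?_ ?_ (hf.continuousAt hnhds)
  · refine (hf.mono ?_).intervalIntegrable
    rw [uIcc_of_le ht.1.le]
    exact Icc_subset_Icc_right ht.2.le
  · exact ⟨_, hnhds, hf.aestronglyMeasurable measurableSet_Icc⟩

variable [PartialOrder E] [IsOrderedAddMonoid E] [IsOrderedModule ℝ E] [ClosedIciTopology E]

theorem le_of_hasDerivAt_nonpos {f f' : ℝ → E} {a b : ℝ} (hab : a ≤ b)
    (hf : ContinuousOn f (Icc a b)) (hf' : ContinuousOn f' (Icc a b))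
    (hderiv : ∀ t ∈ Ioo a b, HasDerivAt f (f' t) t) (hnonpos : ∀ t ∈ Ioo a b, f' t ≤ 0) :
    f b ≤ f a := by
  have hint : IntervalIntegrable f' MeasureTheory.volume a b :=
    (uIcc_of_le hab ▸ hf').intervalIntegrable
  rw [← sub_nonpos, ← intervalIntegral.integral_eq_sub_of_hasDerivAt_of_le hab hf hderiv hint,
    intervalIntegral.integral_of_le hab, MeasureTheory.integral_Ioc_eq_integral_Ioo]
  exact MeasureTheory.integral_nonpos_of_ae <|
    MeasureTheory.ae_restrict_of_forall_mem measurableSet_Ioo hnonpos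

theorem le_exp_integral_smul_of_hasDerivAt_le {f f' : ℝ → E} {k : ℝ → ℝ} {a b : ℝ} (hab : a ≤ b)
    (hf : ContinuousOn f (Icc a b)) (hf' : ContinuousOn f' (Icc a b))
    (hk : ContinuousOn k (Icc a b)) (hderiv : ∀ t ∈ Ioo a b, HasDerivAt f (f' t) t)
    (hle : ∀ t ∈ Ioo a b, f' t ≤ k t • f t) :
    f b ≤ Real.exp (∫ t in a..b, k t) • f a := by
  set K : ℝ → ℝ := fun u => ∫ s in a..u, k s
  have hK : ContinuousOn K (Icc a b) := by
    rw [← uIcc_of_le hab] at hk ⊢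
    exact intervalIntegral.continuousOn_primitive_interval hk.integrableOn_uIcc
  have hexp : ContinuousOn (fun t => Real.exp (-K t)) (Icc a b) := hK.neg.rexp
  have hmono : Real.exp (-K b) • f b ≤ Real.exp (-K a) • f a := by
    refine le_of_hasDerivAt_nonpos (f := fun t => Real.exp (-K t) • f t)
      (f' := fun t => Real.exp (-K t) • (f' t - k t • f t)) hab
      (hexp.smul hf) (hexp.smul (hf'.sub (hk.smul hf))) (fun t ht => ?_) (fun t ht => ?_)
    · have hKt := (hasDerivAt_integral_of_continuousOn hk ht).neg.exp
      refine (hKt.smul (hderiv t ht)).congr_deriv ?_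
      module
    · exact smul_nonpos_of_nonneg_of_nonpos (Real.exp_nonneg _) (sub_nonpos.2 (hle t ht))
  have hKa : K a = 0 := intervalIntegral.integral_same
  rw [hKa, neg_zero, Real.exp_zero, one_smul] at hmono
  have h := smul_le_smul_of_nonneg_left hmono (Real.exp_nonneg (K b))
  rwa [smul_smul, ← Real.exp_add, add_neg_cancel, Real.exp_zero, one_smul] at h

end Calculus

section ContinuousFunctionalCalculus

variable {A : Type*} [CStarAlgebra A]

theorem continuousOn_ringInverse {X : Type*} [TopologicalSpace X] {f : X → A} {s : Set X}
    (hf : ContinuousOn f s) (hu : ∀ x ∈ s, IsUnit (f x)) :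
    ContinuousOn (fun x => (f x)⁻¹ʳ) s := by
  intro x hx
  have hinv := NormedRing.inverse_continuousAt (hu x hx).unit
  rw [IsUnit.unit_spec] at hinv
  exact hinv.comp_continuousWithinAt (hf x hx)

variable [PartialOrder A] [StarOrderedRing A] {a : A}

theorem norm_inverse_one_sub_le (ha : ‖a‖ < 1) : ‖(1 - a)⁻¹ʳ‖ ≤ (1 - ‖a‖)⁻¹ := by
  have hone : ‖(1 : A)‖ ≤ 1 := (CStarAlgebra.norm_le_one_iff_of_nonneg 1 zero_le_one).2 le_rfl
  rw [NormedRing.inverse_one_sub a ha]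
  exact (tsum_geometric_le_of_norm_lt_one a ha).trans (by linarith)

theorem star_mul_mul_add_star_le (a b y : A) :
    star b * y * a + star a * star y * b ≤ ‖y‖ • (star a * a + star b * b) := by
  obtain rfl | hy := eq_or_ne y 0
  · simp
  have hsq : 0 ≤ star (y * a - ‖y‖ • b) * (y * a - ‖y‖ • b) := star_mul_self_nonneg _
  have hexpand : star (y * a - ‖y‖ • b) * (y * a - ‖y‖ • b) =
      star a * (star y * y) * a + ‖y‖ • (‖y‖ • (star b * b)) -
        ‖y‖ • (star b * y * a + star a * star y * b) := by
    simp only [star_sub, star_mul, star_smul, star_trivial, sub_mul, mul_sub, smul_mul_assoc,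
      mul_smul_comm, mul_assoc]
    module
  have hyy : star a * (star y * y) * a ≤ ‖y‖ • (‖y‖ • (star a * a)) := by
    refine (CStarAlgebra.star_left_conjugate_le_norm_smul (.star_mul_self y)).trans_eq ?_
    rw [CStarRing.norm_star_mul_self, mul_smul]
  rw [hexpand, sub_nonneg] at hsq
  refine le_of_smul_le_smul_left (hsq.trans ?_) (norm_pos_iff.2 hy)
  rw [smul_add, smul_add]
  gcongr

theorem spectrum_subset_Icc (ha : 0 ≤ a) : spectrum ℝ a ⊆ Icc 0 ‖a‖ := by
  obtain _ | _ := subsingleton_or_nontrivial A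
  · simp [spectrum.of_subsingleton]
  · exact fun t ht => ⟨spectrum_nonneg_of_nonneg ha ht,
      (le_abs_self t).trans (spectrum.norm_le_norm_of_mem ht)⟩

theorem norm_cfc_of_monotoneOn {f : ℝ → ℝ} (ha : 0 ≤ a) (hf : ContinuousOn f (Icc 0 ‖a‖))
    (hmono : MonotoneOn f (Icc 0 ‖a‖)) (hf₀ : f 0 = 0) : ‖cfc f a‖ = f ‖a‖ := by
  have hnonneg {t : ℝ} (ht : t ∈ Icc 0 ‖a‖) : 0 ≤ f t :=
    hf₀ ▸ hmono (left_mem_Icc.2 (norm_nonneg a)) ht ht.1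
  have hright : ‖a‖ ∈ Icc 0 ‖a‖ := right_mem_Icc.2 (norm_nonneg a)
  refine le_antisymm (norm_cfc_le (hnonneg hright) fun t ht => ?_) ?_
  · have ht' := spectrum_subset_Icc ha ht
    rw [Real.norm_of_nonneg (hnonneg ht')]
    exact hmono ht' hright ht'.2
  · obtain _ | _ := subsingleton_or_nontrivial A
    · simp [Subsingleton.elim a 0, hf₀]
    · exact (le_abs_self _).trans <| norm_apply_le_norm_cfc f a
        (CStarAlgebra.norm_mem_spectrum_of_nonneg ha) (hf.mono (spectrum_subset_Icc ha))
        (.of_nonneg ha)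

end ContinuousFunctionalCalculus

section Cayley

theorem continuousOn_one_add_div_one_sub :
    ContinuousOn (fun t : ℝ => (1 + t) / (1 - t)) (Iio 1) :=
  ContinuousOn.div (by fun_prop) (by fun_prop) fun _ ht => (sub_pos.2 ht).ne'

theorem monotoneOn_one_add_div_one_sub :
    MonotoneOn (fun t : ℝ => (1 + t) / (1 - t)) (Ico 0 1) :=
  Real.strictMonoOn_one_add_div_one_sub.monotoneOn.mono fun _ ht => ⟨by linarith [ht.1], ht.2⟩

theorem one_add_div_one_sub_pos {t : ℝ} (ht : t ∈ Ico (0 : ℝ) 1) : 0 < (1 + t) / (1 - t) :=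
  div_pos (by linarith [ht.1]) (sub_pos.2 ht.2)

variable {A : Type*} [CStarAlgebra A] [PartialOrder A] [StarOrderedRing A] {a : A}

theorem one_add_mul_inverse_one_sub_eq_cfc (ha : 0 ≤ a) (ha₁ : ‖a‖ < 1) :
    (1 + a) * (1 - a)⁻¹ʳ = cfc (fun t : ℝ => (1 + t) / (1 - t)) a := by
  have hne : ∀ t ∈ spectrum ℝ a, 1 - t ≠ 0 := fun t ht =>
    (sub_pos.2 ((spectrum_subset_Icc ha ht).2.trans_lt ha₁)).ne'
  rw [cfc_map_div (fun t => 1 + t) (fun t => 1 - t) a hne,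
    cfc_const_add 1 (fun t => t) a, cfc_sub (fun _ => 1) (fun t => t) a, cfc_const_one ℝ a,
    cfc_id' ℝ a, map_one]

theorem norm_log_one_add_mul_inverse_one_sub (ha : 0 ≤ a) (ha₁ : ‖a‖ < 1) :
    ‖CFC.log ((1 + a) * (1 - a)⁻¹ʳ)‖ = Real.log ((1 + ‖a‖) / (1 - ‖a‖)) := by
  have hIcc : Icc 0 ‖a‖ ⊆ Ico 0 1 := Icc_subset_Ico_right ha₁
  have hcont := continuousOn_one_add_div_one_sub.mono (hIcc.trans Ico_subset_Iio_self)
  have hpos : ∀ t ∈ Icc 0 ‖a‖, 0 < (1 + t) / (1 - t) := fun t ht =>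
    one_add_div_one_sub_pos (hIcc ht)
  have hspec := spectrum_subset_Icc ha
  rw [one_add_mul_inverse_one_sub_eq_cfc ha ha₁, CFC.log,
    ← cfc_comp' Real.log _ a (Real.continuousOn_log.mono ?_) (hcont.mono hspec)]
  · refine norm_cfc_of_monotoneOn ha (hcont.log fun t ht => (hpos t ht).ne') ?_ (by simp)
    exact Real.strictMonoOn_log.monotoneOn.comp (monotoneOn_one_add_div_one_sub.mono hIcc) hpos
  · rintro _ ⟨t, ht, rfl⟩
    exact (hpos t (hspec ht)).ne'

theorem norm_mul_self_mul_one_add_mul_inverse_one_sub (ha : 0 ≤ a) (ha₁ : ‖a‖ < 1) :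
    ‖a * a * ((1 + a) * (1 - a)⁻¹ʳ)‖ = ‖a‖ * ‖a‖ * ((1 + ‖a‖) / (1 - ‖a‖)) := by
  have hIcc : Icc 0 ‖a‖ ⊆ Ico 0 1 := Icc_subset_Ico_right ha₁
  have hcont := continuousOn_one_add_div_one_sub.mono (hIcc.trans Ico_subset_Iio_self)
  have hspec := spectrum_subset_Icc ha
  have hcfc : a * a * ((1 + a) * (1 - a)⁻¹ʳ) =
      cfc (fun t : ℝ => t * t * ((1 + t) / (1 - t))) a := by
    rw [one_add_mul_inverse_one_sub_eq_cfc ha ha₁,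
      cfc_mul (fun t => t * t) _ a (by fun_prop) (hcont.mono hspec), cfc_mul (fun t => t) _ a,
      cfc_id' ℝ a]
  rw [hcfc]
  refine norm_cfc_of_monotoneOn ha (by fun_prop) ?_ (by simp)
  refine MonotoneOn.mul (fun t ht u _ htu => mul_self_le_mul_self ht.1 htu)
    (monotoneOn_one_add_div_one_sub.mono hIcc) (fun t _ => mul_self_nonneg t)
    fun t ht => (one_add_div_one_sub_pos (hIcc ht)).le

end Cayley

section Form

variable {A : Type*} [CStarAlgebra A]

theorem theta_smul_left (x y : A2 A) (a : A) : theta (x <• a) y = star a * theta x y := by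
  change star (x.1 * a) * y.1 - star (x.2 * a) * y.2 = star a * (star x.1 * y.1 - star x.2 * y.2)
  simp only [star_mul, mul_sub, mul_assoc]

theorem theta_smul_right (x y : A2 A) (a : A) : theta x (y <• a) = theta x y * a := by
  change star x.1 * (y.1 * a) - star x.2 * (y.2 * a) = (star x.1 * y.1 - star x.2 * y.2) * a
  simp only [sub_mul, mul_assoc]

theorem theta_sub_right (x y w : A2 A) : theta x (y - w) = theta x y - theta x w := by
  change star x.1 * (y.1 - w.1) - star x.2 * (y.2 - w.2) =
    star x.1 * y.1 - star x.2 * y.2 - (star x.1 * w.1 - star x.2 * w.2)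
  noncomm_ring

theorem star_theta (x y : A2 A) : star (theta x y) = theta y x := by
  simp only [theta, star_sub, star_mul, star_star]

theorem theta_col_left (a b : A) (v : A2 A) : theta (col a b) v = star a * v.1 - star b * v.2 :=
  rfl

end Form

section Disk

variable {A : Type*} [CStarAlgebra A] {z : A}

theorem norm_star_mul_self_lt_one (hz : ‖z‖ < 1) : ‖star z * z‖ < 1 := by
  rw [CStarRing.norm_star_mul_self]
  exact mul_lt_one_of_nonneg_of_lt_one_left (norm_nonneg z) hz hz.le

theorem isUnit_one_sub_star_mul_self (hz : ‖z‖ < 1) : IsUnit (1 - star z * z) :=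
  isUnit_one_sub_of_norm_lt_one (norm_star_mul_self_lt_one hz)

theorem isUnit_one_sub_mul_star_self (hz : ‖z‖ < 1) : IsUnit (1 - z * star z) := by
  simpa only [star_star] using isUnit_one_sub_star_mul_self ((norm_star z).trans_lt hz)

theorem mul_inverse_one_sub_star_mul_self (hz : ‖z‖ < 1) :
    z * (1 - star z * z)⁻¹ʳ = (1 - z * star z)⁻¹ʳ * z :=
  mul_inverse_one_sub_mul (isUnit_one_sub_star_mul_self hz) (isUnit_one_sub_mul_star_self hz)

theorem star_mul_inverse_one_sub_mul_star_self (hz : ‖z‖ < 1) :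
    star z * (1 - z * star z)⁻¹ʳ = (1 - star z * z)⁻¹ʳ * star z :=
  mul_inverse_one_sub_mul (isUnit_one_sub_mul_star_self hz) (isUnit_one_sub_star_mul_self hz)

variable [PartialOrder A] [StarOrderedRing A]

theorem one_sub_star_mul_self_nonneg (hz : ‖z‖ < 1) : 0 ≤ 1 - star z * z :=
  sub_nonneg.2 <| (CStarAlgebra.norm_le_one_iff_of_nonneg _ (star_mul_self_nonneg z)).1
    (norm_star_mul_self_lt_one hz).le

theorem defect_mul_defect (hz : ‖z‖ < 1) : defect z * defect z = 1 - star z * z :=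
  CFC.sqrt_mul_sqrt_self _ (one_sub_star_mul_self_nonneg hz)

theorem isUnit_defect (hz : ‖z‖ < 1) : IsUnit (defect z) :=
  (CFC.isUnit_sqrt_iff _ (one_sub_star_mul_self_nonneg hz)).2 (isUnit_one_sub_star_mul_self hz)

theorem star_inverse_defect (z : A) : star (defect z)⁻¹ʳ = (defect z)⁻¹ʳ :=
  (IsSelfAdjoint.of_nonneg (CFC.sqrt_nonneg _)).ringInverse.star_eq

theorem inverse_defect_mul_inverse_defect (hz : ‖z‖ < 1) :
    (defect z)⁻¹ʳ * (defect z)⁻¹ʳ = (1 - star z * z)⁻¹ʳ := by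
  rw [← defect_mul_defect hz, Ring.inverse_mul (.inl (isUnit_defect hz))]

theorem norm_inverse_defect_sq_le (hz : ‖z‖ < 1) :
    ‖(defect z)⁻¹ʳ‖ ^ 2 ≤ (1 - ‖z‖ ^ 2)⁻¹ := by
  have h := norm_inverse_one_sub_le (norm_star_mul_self_lt_one hz)
  rwa [← inverse_defect_mul_inverse_defect hz, IsSelfAdjoint.norm_mul_self (star_inverse_defect z),
    CStarRing.norm_star_mul_self, ← sq ‖z‖] at h

/-- The generator `(z⋆, 1) (1 - z z⋆) ^ (-1/2)` of the `θ`-orthogonal complement of `ℓ_z`, on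
which `θ` takes the value `-1`. -/
def perpGen (z : A) : A2 A := col (star z) 1 <• (defect (star z))⁻¹ʳ

/-- The coordinate `(1 - z z⋆) ^ (-1/2) X (1 - z⋆ z) ^ (-1/2)` of `tangentRep z X` in the basis
`perpGen z` of the `θ`-orthogonal complement of `ℓ_z`. -/
def tangentCoord (z X : A) : A := (defect (star z))⁻¹ʳ * X * (defect z)⁻¹ʳ

theorem gen_smul_theta_gen (hz : ‖z‖ < 1) (v : A2 A) :
    gen z <• theta (gen z) v = col 1 z <• ((1 - star z * z)⁻¹ʳ * theta (col 1 z) v) := by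
  rw [gen, theta_smul_left, smul_smul, ← MulOpposite.op_mul, star_inverse_defect, ← mul_assoc,
    inverse_defect_mul_inverse_defect hz]

theorem perpGen_smul_theta_perpGen (hz : ‖z‖ < 1) (v : A2 A) :
    perpGen z <• theta (perpGen z) v =
      col (star z) 1 <• ((1 - z * star z)⁻¹ʳ * theta (col (star z) 1) v) := by
  rw [perpGen, theta_smul_left, smul_smul, ← MulOpposite.op_mul, star_inverse_defect, ← mul_assoc,
    inverse_defect_mul_inverse_defect ((norm_star z).trans_lt hz), star_star]

theorem gen_smul_theta_sub_perpGen_smul_theta (hz : ‖z‖ < 1) (v : A2 A) :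
    gen z <• theta (gen z) v - perpGen z <• theta (perpGen z) v = v := by
  have hP := Ring.inverse_mul_cancel _ (isUnit_one_sub_star_mul_self hz)
  have hQ := Ring.inverse_mul_cancel _ (isUnit_one_sub_mul_star_self hz)
  rw [gen_smul_theta_gen hz, perpGen_smul_theta_perpGen hz, theta_col_left, theta_col_left,
    star_one, one_mul, star_star, one_mul]
  refine Prod.ext ?_ ?_
  · change 1 * ((1 - star z * z)⁻¹ʳ * (v.1 - star z * v.2)) -
      star z * ((1 - z * star z)⁻¹ʳ * (z * v.1 - v.2)) = v.1
    rw [← mul_assoc (star z), star_mul_inverse_one_sub_mul_star_self hz]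
    calc _ = (1 - star z * z)⁻¹ʳ * (1 - star z * z) * v.1 := by noncomm_ring
      _ = v.1 := by rw [hP, one_mul]
  · change z * ((1 - star z * z)⁻¹ʳ * (v.1 - star z * v.2)) -
      1 * ((1 - z * star z)⁻¹ʳ * (z * v.1 - v.2)) = v.2
    rw [← mul_assoc z, mul_inverse_one_sub_star_mul_self hz]
    calc _ = (1 - z * star z)⁻¹ʳ * (1 - z * star z) * v.2 := by noncomm_ring
      _ = v.2 := by rw [hQ, one_mul]

theorem theta_self_eq (hz : ‖z‖ < 1) (v : A2 A) :
    theta v v = star (theta (gen z) v) * theta (gen z) v -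
      star (theta (perpGen z) v) * theta (perpGen z) v := by
  calc theta v v
    _ = theta v (gen z <• theta (gen z) v - perpGen z <• theta (perpGen z) v) := by
      rw [gen_smul_theta_sub_perpGen_smul_theta hz]
    _ = _ := by
      rw [theta_sub_right, theta_smul_right, theta_smul_right, star_theta, star_theta]

theorem theta_perpGen_self (hz : ‖z‖ < 1) : theta (perpGen z) (perpGen z) = -1 := by
  have hz' := (norm_star z).trans_lt hz
  have hcol : theta (col (star z) 1) (col (star z) 1) =
      -(defect (star z) * defect (star z)) := by
    rw [defect_mul_defect hz', theta_col_left]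
    change star (star z) * star z - star 1 * 1 = _
    rw [star_one, one_mul, neg_sub]
  rw [perpGen, theta_smul_left, theta_smul_right, hcol, star_inverse_defect, neg_mul, mul_neg,
    ← mul_assoc, ← mul_assoc, Ring.inverse_mul_cancel _ (isUnit_defect hz'), one_mul,
    Ring.mul_inverse_cancel _ (isUnit_defect hz')]

theorem tangentRep_eq (hz : ‖z‖ < 1) (X : A) : tangentRep z X = perpGen z <• tangentCoord z X := by
  have hlift : theta (perpGen z) (lift z X) = -tangentCoord z X := by
    rw [perpGen, lift, theta_smul_left, theta_smul_right, star_inverse_defect, theta_col_left]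
    change (defect (star z))⁻¹ʳ * ((star (star z) * 0 - star 1 * X) * (defect z)⁻¹ʳ) = _
    simp only [tangentCoord, mul_zero, star_one, one_mul, zero_sub, neg_mul, mul_neg, mul_assoc]
  have hdecomp := gen_smul_theta_sub_perpGen_smul_theta hz (lift z X)
  rw [hlift, MulOpposite.op_neg, neg_smul, sub_neg_eq_add] at hdecomp
  exact sub_eq_iff_eq_add'.2 hdecomp.symm

theorem finslerNorm_eq_norm_tangentCoord (hz : ‖z‖ < 1) (X : A) :
    finslerNorm z X = ‖tangentCoord z X‖ := by
  rw [finslerNorm, tangentRep_eq hz, theta_smul_left, theta_smul_right, theta_perpGen_self hz,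
    neg_one_mul, mul_neg, norm_neg, CStarRing.norm_star_mul_self,
    Real.sqrt_mul_self (norm_nonneg _)]

theorem finslerNorm_le (hz : ‖z‖ < 1) (X : A) : finslerNorm z X ≤ ‖X‖ / (1 - ‖z‖ ^ 2) := by
  have hgen := norm_inverse_defect_sq_le hz
  have hperp := norm_inverse_defect_sq_le ((norm_star z).trans_lt hz)
  rw [norm_star] at hperp
  rw [finslerNorm_eq_norm_tangentCoord hz]
  calc ‖tangentCoord z X‖ ≤ ‖(defect (star z))⁻¹ʳ‖ * ‖X‖ * ‖(defect z)⁻¹ʳ‖ := norm_mul₃_le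
    _ = ‖X‖ * (‖(defect (star z))⁻¹ʳ‖ * ‖(defect z)⁻¹ʳ‖) := by ring
    _ ≤ ‖X‖ * (1 - ‖z‖ ^ 2)⁻¹ := by
      gcongr
      linarith [two_mul_le_add_sq ‖(defect (star z))⁻¹ʳ‖ ‖(defect z)⁻¹ʳ‖]
    _ = ‖X‖ / (1 - ‖z‖ ^ 2) := (div_eq_mul_inv _ _).symm

end Disk

section LineNorm

variable {A : Type*} [CStarAlgebra A] {z : A}

/-- The `A`-valued square `θ(e_z, v)⋆ θ(e_z, v)` of the `ℓ_z`-component of `v`. It is written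
without square roots, so that its derivative in `z` is explicit. -/
def lineNormSq (z : A) (v : A2 A) : A :=
  star (theta (col 1 z) v) * (1 - star z * z)⁻¹ʳ * theta (col 1 z) v

theorem hasDerivAt_inverse_one_sub_star_mul_self {γ : ℝ → A} {X : A} {t : ℝ}
    (hγ : HasDerivAt γ X t) (hD : ‖γ t‖ < 1) :
    HasDerivAt (fun t => (1 - star (γ t) * γ t)⁻¹ʳ)
      ((1 - star (γ t) * γ t)⁻¹ʳ * (star X * γ t + star (γ t) * X) *
        (1 - star (γ t) * γ t)⁻¹ʳ) t := by
  obtain ⟨u, hu⟩ := isUnit_one_sub_star_mul_self hD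
  have h := (hasFDerivAt_ringInverse (𝕜 := ℝ) u).comp_hasDerivAt_of_eq t
    ((hγ.star.mul hγ).const_sub 1) hu
  refine h.congr_deriv ?_
  rw [← hu, Ring.inverse_unit]
  change -(↑u⁻¹ * -(star X * γ t + star (γ t) * X) * ↑u⁻¹) = _
  rw [mul_neg, neg_mul, neg_neg]

theorem star_theta_col_star_mul_inverse (hz : ‖z‖ < 1) (v : A2 A) :
    star (theta (col (star z) 1) v) * (1 - z * star z)⁻¹ʳ =
      star (theta (col 1 z) v) * (1 - star z * z)⁻¹ʳ * star z - star v.2 := by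
  have hinv := inverse_one_sub_eq_one_add (isUnit_one_sub_mul_star_self hz)
  rw [theta_col_left, theta_col_left, mul_assoc _ _ (star z),
    ← star_mul_inverse_one_sub_mul_star_self hz]
  simp only [star_sub, star_mul, star_star, star_one, mul_one, sub_mul]
  linear_combination (norm := noncomm_ring) -star v.2 * hinv

variable [PartialOrder A] [StarOrderedRing A]

theorem lineNormSq_eq (hz : ‖z‖ < 1) (v : A2 A) :
    lineNormSq z v = star (theta (gen z) v) * theta (gen z) v := by
  rw [lineNormSq, ← inverse_defect_mul_inverse_defect hz, gen, theta_smul_left, star_mul,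
    star_star, star_inverse_defect]
  simp only [mul_assoc]

theorem star_theta_perpGen_mul_tangentCoord_mul_theta_gen (hz : ‖z‖ < 1) (v : A2 A) (X : A) :
    star (theta (perpGen z) v) * tangentCoord z X * theta (gen z) v =
      (star (theta (col 1 z) v) * (1 - star z * z)⁻¹ʳ * star z - star v.2) * X *
        (1 - star z * z)⁻¹ʳ * theta (col 1 z) v := by
  have hperp := inverse_defect_mul_inverse_defect ((norm_star z).trans_lt hz)
  rw [star_star] at hperp
  rw [← star_theta_col_star_mul_inverse hz, ← hperp, ← inverse_defect_mul_inverse_defect hz,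
    perpGen, gen, tangentCoord, theta_smul_left, theta_smul_left, star_mul, star_star,
    star_inverse_defect]
  simp only [mul_assoc]

theorem hasDerivAt_lineNormSq {γ : ℝ → A} {X : A} {t : ℝ} (hγ : HasDerivAt γ X t)
    (hD : ‖γ t‖ < 1) (v : A2 A) :
    HasDerivAt (fun t => lineNormSq (γ t) v)
      (star (theta (perpGen (γ t)) v) * tangentCoord (γ t) X * theta (gen (γ t)) v +
        star (theta (gen (γ t)) v) * star (tangentCoord (γ t) X) * theta (perpGen (γ t)) v) t := by
  have htheta : HasDerivAt (fun t => theta (col 1 (γ t)) v) (-(star X * v.2)) t :=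
    (hγ.star.mul_const v.2).const_sub (star 1 * v.1)
  have hprod := (htheta.star.mul (hasDerivAt_inverse_one_sub_star_mul_self hγ hD)).mul htheta
  refine hprod.congr_deriv ?_
  have hself : star (1 - star (γ t) * γ t)⁻¹ʳ = (1 - star (γ t) * γ t)⁻¹ʳ := by
    rw [← Ring.inverse_star]
    simp only [star_sub, star_one, star_mul, star_star]
  have hadj : star (theta (gen (γ t)) v) * star (tangentCoord (γ t) X) * theta (perpGen (γ t)) v =
      star (star (theta (perpGen (γ t)) v) * tangentCoord (γ t) X * theta (gen (γ t)) v) := by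
    simp only [star_mul, star_star, mul_assoc]
  rw [hadj, star_theta_perpGen_mul_tangentCoord_mul_theta_gen hD]
  simp only [star_mul, star_sub, star_neg, star_star, hself, Pi.mul_apply]
  noncomm_ring

theorem lineNormSq_deriv_le (hz : ‖z‖ < 1) {v : A2 A} (hv : theta v v = 0) (X : A) :
    star (theta (perpGen z) v) * tangentCoord z X * theta (gen z) v +
        star (theta (gen z) v) * star (tangentCoord z X) * theta (perpGen z) v ≤
      (2 * finslerNorm z X) • lineNormSq z v := by
  have hnull := theta_self_eq hz v
  rw [hv, eq_comm, sub_eq_zero] at hnull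
  refine (star_mul_mul_add_star_le _ _ _).trans_eq ?_
  rw [← hnull, ← two_smul ℝ, smul_smul, ← lineNormSq_eq hz,
    ← finslerNorm_eq_norm_tangentCoord hz, mul_comm]

end LineNorm

section Curves

variable {A : Type*} [CStarAlgebra A] [PartialOrder A] [StarOrderedRing A]
  {γ X : ℝ → A} {s : Set ℝ}

theorem length_nonneg (γ : ℝ → A) : 0 ≤ length γ :=
  intervalIntegral.integral_nonneg zero_le_one fun _ _ => Real.sqrt_nonneg _

theorem continuousOn_inverse_defect (hγ : ContinuousOn γ s) (hD : ∀ t ∈ s, ‖γ t‖ < 1) :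
    ContinuousOn (fun t => (defect (γ t))⁻¹ʳ) s :=
  continuousOn_ringInverse
    (CFC.continuousOn_sqrt.comp (continuousOn_const.sub (hγ.star.mul hγ))
      fun t ht => one_sub_star_mul_self_nonneg (hD t ht))
    fun t ht => isUnit_defect (hD t ht)

theorem continuousOn_inverse_defect_star (hγ : ContinuousOn γ s) (hD : ∀ t ∈ s, ‖γ t‖ < 1) :
    ContinuousOn (fun t => (defect (star (γ t)))⁻¹ʳ) s :=
  continuousOn_inverse_defect hγ.star fun t ht => (norm_star _).trans_lt (hD t ht)

theorem continuousOn_tangentCoord (hγ : ContinuousOn γ s) (hX : ContinuousOn X s)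
    (hD : ∀ t ∈ s, ‖γ t‖ < 1) : ContinuousOn (fun t => tangentCoord (γ t) (X t)) s :=
  ((continuousOn_inverse_defect_star hγ hD).mul hX).mul (continuousOn_inverse_defect hγ hD)

theorem continuousOn_finslerNorm (hγ : ContinuousOn γ s) (hX : ContinuousOn X s)
    (hD : ∀ t ∈ s, ‖γ t‖ < 1) : ContinuousOn (fun t => finslerNorm (γ t) (X t)) s :=
  (continuousOn_tangentCoord hγ hX hD).norm.congr fun t ht =>
    finslerNorm_eq_norm_tangentCoord (hD t ht) _

theorem continuousOn_theta_gen (hγ : ContinuousOn γ s) (hD : ∀ t ∈ s, ‖γ t‖ < 1) (v : A2 A) :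
    ContinuousOn (fun t => theta (gen (γ t)) v) s := by
  simp only [gen, theta_smul_left, star_inverse_defect, theta_col_left]
  exact (continuousOn_inverse_defect hγ hD).mul
    (continuousOn_const.sub (hγ.star.mul continuousOn_const))

theorem continuousOn_theta_perpGen (hγ : ContinuousOn γ s) (hD : ∀ t ∈ s, ‖γ t‖ < 1) (v : A2 A) :
    ContinuousOn (fun t => theta (perpGen (γ t)) v) s := by
  simp only [perpGen, theta_smul_left, star_inverse_defect, theta_col_left, star_star]
  exact (continuousOn_inverse_defect_star hγ hD).mul
    ((hγ.mul continuousOn_const).sub continuousOn_const)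

theorem lineNormSq_le_exp_length_smul (hγ : ContDiffOn ℝ 1 γ (Icc 0 1))
    (hD : ∀ t ∈ Icc (0 : ℝ) 1, ‖γ t‖ < 1) {v : A2 A} (hv : theta v v = 0) :
    lineNormSq (γ 1) v ≤ Real.exp (2 * length γ) • lineNormSq (γ 0) v := by
  have hγ' : ContinuousOn (derivWithin γ (Icc 0 1)) (Icc 0 1) :=
    hγ.continuousOn_derivWithin (uniqueDiffOn_Icc zero_lt_one) le_rfl
  have hgen := continuousOn_theta_gen hγ.continuousOn hD v
  have hperp := continuousOn_theta_perpGen hγ.continuousOn hD v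
  have htan := continuousOn_tangentCoord hγ.continuousOn hγ' hD
  have hderiv : ∀ t ∈ Ioo (0 : ℝ) 1, HasDerivAt γ (derivWithin γ (Icc 0 1) t) t := fun t ht =>
    ((hγ.differentiableOn one_ne_zero t (Ioo_subset_Icc_self ht)).hasDerivWithinAt).hasDerivAt
      (Icc_mem_nhds ht.1 ht.2)
  rw [length, ← intervalIntegral.integral_const_mul]
  exact le_exp_integral_smul_of_hasDerivAt_le zero_le_one
    ((hgen.star.mul hgen).congr fun t ht => lineNormSq_eq (hD t ht) v)
    (((hperp.star.mul htan).mul hgen).add ((hgen.star.mul htan.star).mul hperp))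
    (continuousOn_const.mul (continuousOn_finslerNorm hγ.continuousOn hγ' hD))
    (fun t ht => hasDerivAt_lineNormSq (hderiv t ht) (hD t (Ioo_subset_Icc_self ht)) v)
    (fun t ht => lineNormSq_deriv_le (hD t (Ioo_subset_Icc_self ht)) hv _)

end Curves

section NullVector

variable {A : Type*} [CStarAlgebra A] [PartialOrder A] [StarOrderedRing A] {z : A}

theorem isSelfAdjoint_abs (z : A) : IsSelfAdjoint (CFC.abs z) :=
  .of_nonneg (CFC.abs_nonneg z)

theorem theta_col_abs_neg (z : A) :
    theta (col (CFC.abs z) (-z)) (col (CFC.abs z) (-z)) = 0 := by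
  change star (CFC.abs z) * CFC.abs z - star (-z) * -z = 0
  rw [(isSelfAdjoint_abs z).star_eq, CFC.abs_mul_abs, star_neg, neg_mul_neg, sub_self]

theorem lineNormSq_zero_col_abs_neg (z : A) :
    lineNormSq 0 (col (CFC.abs z) (-z)) = CFC.abs z * CFC.abs z := by
  have htheta : theta (col 1 0) (col (CFC.abs z) (-z)) = CFC.abs z := by
    change star 1 * CFC.abs z - star 0 * -z = CFC.abs z
    rw [star_one, one_mul, star_zero, zero_mul, sub_zero]
  rw [lineNormSq, htheta, (isSelfAdjoint_abs z).star_eq, mul_zero, sub_zero,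
    Ring.inverse_one, mul_one]

theorem lineNormSq_col_abs_neg (hz : ‖z‖ < 1) :
    lineNormSq z (col (CFC.abs z) (-z)) =
      CFC.abs z * CFC.abs z * ((1 + CFC.abs z) * (1 - CFC.abs z)⁻¹ʳ) := by
  set a := CFC.abs z
  have ha : ‖a‖ < 1 := CFC.norm_abs.trans_lt hz
  have hadd : IsUnit (1 + a) := by
    simpa using isUnit_one_sub_of_norm_lt_one ((norm_neg a).trans_lt ha)
  have htheta : theta (col 1 z) (col a (-z)) = (1 + a) * a := by
    change star 1 * a - star z * -z = (1 + a) * a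
    rw [star_one, one_mul, mul_neg, sub_neg_eq_add, ← CFC.abs_mul_abs, add_mul, one_mul]
  have hinv : (1 - star z * z)⁻¹ʳ * (1 + a) = (1 - a)⁻¹ʳ := by
    have hfactor : 1 - star z * z = (1 + a) * (1 - a) := by
      rw [← CFC.abs_mul_abs]
      noncomm_ring
    rw [hfactor, Ring.inverse_mul (.inl hadd), mul_assoc, Ring.inverse_mul_cancel _ hadd, mul_one]
  have hcomm : Commute a (1 - a)⁻¹ʳ :=
    commute_inverse_one_sub (isUnit_one_sub_of_norm_lt_one ha)
  have hstar : star a = a := (isSelfAdjoint_abs z).star_eq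
  calc lineNormSq z (col a (-z))
    _ = a * (1 + a) * ((1 - star z * z)⁻¹ʳ * (1 + a) * a) := by
      rw [lineNormSq, htheta, star_mul, star_add, star_one, hstar]
      simp only [mul_assoc]
    _ = a * a * ((1 + a) * (1 - a)⁻¹ʳ) := by
      rw [hinv, ← hcomm.eq]
      noncomm_ring

theorem half_log_le_length {γ : ℝ → A} (hγ : ContDiffOn ℝ 1 γ (Icc 0 1))
    (hD : ∀ t ∈ Icc (0 : ℝ) 1, ‖γ t‖ < 1) (hγ₀ : γ 0 = 0) :
    (1 / 2 : ℝ) * Real.log ((1 + ‖γ 1‖) / (1 - ‖γ 1‖)) ≤ length γ := by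
  have hγ₁ := hD 1 (right_mem_Icc.2 zero_le_one)
  obtain hzero | hne := eq_or_ne ‖γ 1‖ 0
  · simpa [hzero] using length_nonneg γ
  have hle := lineNormSq_le_exp_length_smul hγ hD (theta_col_abs_neg (γ 1))
  have hnonneg : 0 ≤ lineNormSq (γ 1) (col (CFC.abs (γ 1)) (-γ 1)) := by
    rw [lineNormSq_eq hγ₁]
    exact star_mul_self_nonneg _
  have hnorm := CStarAlgebra.norm_le_norm_of_nonneg_of_le hnonneg hle
  rw [lineNormSq_col_abs_neg hγ₁, hγ₀, lineNormSq_zero_col_abs_neg, norm_smul,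
    Real.norm_of_nonneg (Real.exp_nonneg _),
    norm_mul_self_mul_one_add_mul_inverse_one_sub (CFC.abs_nonneg _) (CFC.norm_abs.trans_lt hγ₁),
    (isSelfAdjoint_abs (γ 1)).norm_mul_self, CFC.norm_abs, ← sq, mul_comm] at hnorm
  have hratio := le_of_mul_le_mul_right hnorm (by positivity)
  have hlog := (Real.log_le_iff_le_exp (one_add_div_one_sub_pos ⟨norm_nonneg _, hγ₁⟩)).2 hratio
  linarith

end NullVector

section Segment

theorem mul_lt_one_of_mem_Icc {r t : ℝ} (ht : t ∈ Icc (0 : ℝ) 1) (hr : r ∈ Ico (0 : ℝ) 1) :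
    t * r < 1 :=
  (mul_le_of_le_one_left hr.1 ht.2).trans_lt hr.2

theorem continuousOn_div_one_sub_sq {r : ℝ} (hr : r ∈ Ico (0 : ℝ) 1) :
    ContinuousOn (fun t : ℝ => r / (1 - (t * r) ^ 2)) (Icc 0 1) :=
  ContinuousOn.div (by fun_prop) (by fun_prop) fun _ ht => ne_of_gt <| sub_pos.2 <|
    pow_lt_one₀ (mul_nonneg ht.1 hr.1) (mul_lt_one_of_mem_Icc ht hr) two_ne_zero

theorem integral_div_one_sub_sq {r : ℝ} (hr : r ∈ Ico (0 : ℝ) 1) :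
    ∫ t in (0 : ℝ)..1, r / (1 - (t * r) ^ 2) = (1 / 2 : ℝ) * Real.log ((1 + r) / (1 - r)) := by
  have hcont := continuousOn_div_one_sub_sq hr
  rw [← uIcc_of_le zero_le_one] at hcont
  have hderiv : ∀ t ∈ uIcc (0 : ℝ) 1, HasDerivAt
      (fun t => (1 / 2 : ℝ) * Real.log ((1 + t * r) / (1 - t * r))) (r / (1 - (t * r) ^ 2)) t := by
    intro t ht
    rw [uIcc_of_le zero_le_one] at ht
    refine hasDerivAt_half_log_one_add_div_one_sub ?_
    rw [abs_of_nonneg (mul_nonneg ht.1 hr.1)]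
    exact mul_lt_one_of_mem_Icc ht hr
  rw [intervalIntegral.integral_eq_sub_of_hasDerivAt hderiv hcont.intervalIntegrable]
  simp

variable {E : Type*} [NormedAddCommGroup E] [NormedSpace ℝ E] {z : E}

theorem norm_smul_eq_of_mem_Icc {t : ℝ} (ht : t ∈ Icc (0 : ℝ) 1) : ‖t • z‖ = t * ‖z‖ := by
  rw [norm_smul, Real.norm_of_nonneg ht.1]

theorem norm_smul_lt_one_of_mem_Icc (hz : ‖z‖ < 1) {t : ℝ} (ht : t ∈ Icc (0 : ℝ) 1) :
    ‖t • z‖ < 1 :=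
  (norm_smul_eq_of_mem_Icc ht).trans_lt (mul_lt_one_of_mem_Icc ht ⟨norm_nonneg z, hz⟩)

theorem derivWithin_smul_Icc {t : ℝ} (ht : t ∈ Icc (0 : ℝ) 1) :
    derivWithin (fun t : ℝ => t • z) (Icc 0 1) t = z := by
  have h : HasDerivAt (fun t : ℝ => t • z) z t := by
    simpa only [one_smul] using (hasDerivAt_id' t).smul_const z
  exact h.hasDerivWithinAt.derivWithin (uniqueDiffOn_Icc zero_lt_one t ht)

variable {A : Type*} [CStarAlgebra A] [PartialOrder A] [StarOrderedRing A] {z : A}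

theorem length_segment_le (hz : ‖z‖ < 1) :
    length (fun t : ℝ => t • z) ≤ (1 / 2 : ℝ) * Real.log ((1 + ‖z‖) / (1 - ‖z‖)) := by
  have hr : ‖z‖ ∈ Ico (0 : ℝ) 1 := ⟨norm_nonneg z, hz⟩
  have hderiv : ContinuousOn (derivWithin (fun t : ℝ => t • z) (Icc 0 1)) (Icc 0 1) :=
    continuousOn_const.congr fun _ ht => derivWithin_smul_Icc ht
  have hcont := continuousOn_finslerNorm (γ := fun t : ℝ => t • z) (by fun_prop) hderiv
    fun _ ht => norm_smul_lt_one_of_mem_Icc hz ht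
  rw [← integral_div_one_sub_sq hr, length]
  refine intervalIntegral.integral_mono_on zero_le_one (hcont.intervalIntegrable_of_Icc zero_le_one)
    ((continuousOn_div_one_sub_sq hr).intervalIntegrable_of_Icc zero_le_one) fun t ht => ?_
  rw [derivWithin_smul_Icc ht, ← norm_smul_eq_of_mem_Icc ht]
  exact finslerNorm_le (norm_smul_lt_one_of_mem_Icc hz ht) z

theorem finslerDist_zero_left (hz : ‖z‖ < 1) :
    finslerDist 0 z = (1 / 2 : ℝ) * Real.log ((1 + ‖z‖) / (1 - ‖z‖)) := by
  rw [finslerDist]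
  set lengths := {L : ℝ | ∃ γ : ℝ → A, ContDiffOn ℝ 1 γ (Icc 0 1) ∧
    (∀ t ∈ Icc (0 : ℝ) 1, ‖γ t‖ < 1) ∧ γ 0 = 0 ∧ γ 1 = z ∧ L = length γ}
  have hsegment : length (fun t : ℝ => t • z) ∈ lengths :=
    ⟨fun t => t • z, by fun_prop, fun _ ht => norm_smul_lt_one_of_mem_Icc hz ht, zero_smul ℝ z,
      one_smul ℝ z, rfl⟩
  have hle : ∀ L ∈ lengths, (1 / 2 : ℝ) * Real.log ((1 + ‖z‖) / (1 - ‖z‖)) ≤ L := by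
    rintro _ ⟨γ, hγ, hD, hγ₀, rfl, rfl⟩
    exact half_log_le_length hγ hD hγ₀
  exact le_antisymm ((csInf_le ⟨_, hle⟩ hsegment).trans (length_segment_le hz))
    (le_csInf ⟨_, hsegment⟩ hle)

end Segment

section CrossRatio

variable {A : Type*} [CStarAlgebra A] {z b : A}

theorem coe_eq_col_smul (x : line z) : (x : A2 A) = col 1 z <• (x : A2 A).1 := by
  obtain ⟨x, hx⟩ := x
  obtain ⟨c, rfl⟩ := Submodule.mem_span_singleton.1 hx
  change c • col 1 z = col 1 z <• (1 * c.unop)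
  rw [one_mul, MulOpposite.op_unop]

variable [PartialOrder A] [StarOrderedRing A]

theorem one_add_star_mul_self_nonneg (z : A) : 0 ≤ 1 + star z * z :=
  add_nonneg zero_le_one (star_mul_self_nonneg z)

theorem isUnit_sqrt_one_add_star_mul_self (z : A) : IsUnit (CFC.sqrt (1 + star z * z)) :=
  (CFC.isUnit_sqrt_iff _ (one_add_star_mul_self_nonneg z)).2
    (isStrictlyPositive_one.add_nonneg (star_mul_self_nonneg z)).isUnit

theorem norm_col_smul (z a : A) : ‖col 1 z <• a‖ = ‖CFC.sqrt (1 + star z * z) * a‖ := by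
  have hself : star (CFC.sqrt (1 + star z * z)) = CFC.sqrt (1 + star z * z) :=
    (IsSelfAdjoint.of_nonneg (CFC.sqrt_nonneg _)).star_eq
  have hinner : star (1 * a) * (1 * a) + star (z * a) * (z * a) =
      star (CFC.sqrt (1 + star z * z) * a) * (CFC.sqrt (1 + star z * z) * a) :=
    calc _ = star a * (1 + star z * z) * a := by
          rw [one_mul, star_mul z a]
          noncomm_ring
      _ = star a * (CFC.sqrt (1 + star z * z) * CFC.sqrt (1 + star z * z)) * a := by
          rw [CFC.sqrt_mul_sqrt_self _ (one_add_star_mul_self_nonneg z)]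
      _ = _ := by
          rw [star_mul _ a, hself]
          simp only [mul_assoc]
  rw [WithCStarModule.prod_norm]
  change √‖MulOpposite.op (star (1 * a) * (1 * a) + star (z * a) * (z * a))‖ = _
  rw [MulOpposite.norm_op, hinner, CStarRing.norm_star_mul_self, Real.sqrt_mul_self (norm_nonneg _)]

theorem norm_endo_apply (hb : Commute b (star z * z)) (x : line z) :
    ‖(endo z b x : A2 A)‖ = ‖b * (CFC.sqrt (1 + star z * z) * (x : A2 A).1)‖ := by
  have hcomm : Commute (CFC.sqrt (1 + star z * z)) b :=
    ((Commute.one_left b).add_left hb.symm).cfcₙ_nnreal _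
  change ‖col 1 z <• (b * (x : A2 A).1)‖ = _
  rw [norm_col_smul, ← mul_assoc, hcomm.eq, mul_assoc]

theorem opNorm_endo (hb : Commute b (star z * z)) : opNorm (endo z b) = ‖b‖ := by
  have hnorm (x : line z) : ‖(x : A2 A)‖ = ‖CFC.sqrt (1 + star z * z) * (x : A2 A).1‖ := by
    rw [← norm_col_smul, ← coe_eq_col_smul]
  have hmem : 0 ≤ ‖b‖ ∧ ∀ x : line z, ‖(endo z b x : A2 A)‖ ≤ ‖b‖ * ‖(x : A2 A)‖ := by
    refine ⟨norm_nonneg b, fun x => ?_⟩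
    rw [norm_endo_apply hb, hnorm]
    exact norm_mul_le _ _
  refine le_antisymm (csInf_le ⟨0, fun C hC => hC.1⟩ hmem) (le_csInf ⟨_, hmem⟩ ?_)
  rintro C ⟨hC₀, hC⟩
  obtain _ | _ := subsingleton_or_nontrivial A
  · rwa [Subsingleton.elim b 0, norm_zero]
  · have h := hC ⟨col 1 z <• (CFC.sqrt (1 + star z * z))⁻¹ʳ, col_smul_mem_line z _⟩
    have hfst : (col 1 z <• (CFC.sqrt (1 + star z * z))⁻¹ʳ).1 = (CFC.sqrt (1 + star z * z))⁻¹ʳ :=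
      one_mul _
    rwa [norm_endo_apply hb, hnorm, hfst,
      Ring.mul_inverse_cancel _ (isUnit_sqrt_one_add_star_mul_self z), mul_one, CStarRing.norm_one,
      mul_one] at h

theorem commute_defect (hb : Commute b (star z * z)) : Commute (defect z) b :=
  ((Commute.one_left b).sub_left hb.symm).cfcₙ_nnreal _

theorem endMatrix_endo (hz : ‖z‖ < 1) (hb : Commute b (star z * z)) :
    endMatrix (endo z b) = b := by
  change defect z * (1 * (b * (1 * (defect z)⁻¹ʳ))) = b
  rw [one_mul, one_mul, ← mul_assoc, (commute_defect hb).eq, mul_assoc,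
    Ring.mul_inverse_cancel _ (isUnit_defect hz), mul_one]

theorem ofMatrix_eq_endo (hz : ‖z‖ < 1) (hb : Commute b (star z * z)) :
    ofMatrix z b = endo z b := by
  rw [ofMatrix, mul_assoc, ← (commute_defect hb).eq, ← mul_assoc,
    Ring.inverse_mul_cancel _ (isUnit_defect hz), one_mul]

theorem opNorm_endLog_endo (hz : ‖z‖ < 1) (hb : Commute b (star z * z)) :
    opNorm (endLog (endo z b)) = ‖CFC.log b‖ := by
  have hlog : Commute (CFC.log b) (star z * z) := hb.cfc_real _
  rw [endLog, endMatrix_endo hz hb, ofMatrix_eq_endo hz hlog, opNorm_endo hlog]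

theorem opNorm_endLog_crossRatio (hz : ‖z‖ < 1) :
    opNorm (endLog (crossRatio z)) = Real.log ((1 + ‖z‖) / (1 - ‖z‖)) := by
  have habs : ‖CFC.abs z‖ < 1 := CFC.norm_abs.trans_lt hz
  have hcomm : Commute ((1 + CFC.abs z) * (1 - CFC.abs z)⁻¹ʳ) (CFC.abs z) :=
    ((Commute.one_left _).add_left (Commute.refl _)).mul_left
      (commute_inverse_one_sub (isUnit_one_sub_of_norm_lt_one habs)).symm
  have hcommSq := hcomm.mul_right hcomm
  rw [CFC.abs_mul_abs] at hcommSq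
  rw [crossRatio, opNorm_endLog_endo hz hcommSq,
    norm_log_one_add_mul_inverse_one_sub (CFC.abs_nonneg z) habs, CFC.norm_abs]

end CrossRatio

end PoincareDisk

end

theorem theorem9 {A : Type*} [CStarAlgebra A] [PartialOrder A] [StarOrderedRing A]
    (z : A) (hz : ‖z‖ < 1) :
    (1 / 2 : ℝ) * PoincareDisk.opNorm (PoincareDisk.endLog (PoincareDisk.crossRatio z)) =
        PoincareDisk.finslerDist 0 z ∧
      PoincareDisk.finslerDist 0 z = (1 / 2 : ℝ) * Real.log ((1 + ‖z‖) / (1 - ‖z‖)) := by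
  rw [PoincareDisk.opNorm_endLog_crossRatio hz, PoincareDisk.finslerDist_zero_left hz]
  exact ⟨rfl, rfl⟩
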